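/- **Setting.** Let $\mathrm{fin}(\mathbb N)$ be the countable set of finite ordered multisets of $\mathbb N$, i.e. finite sequences $s=(s_1,\dots,s_r)$ of elements of $\mathbb N$ with repetitions allowed (possibly directed edges of any finite arity). For an index set $S$, an interaction process is a map $\mathcal I:S\to\mathrm{fin}(\mathbb N)$; its vertices are the elements of $\mathbb N$ that occur in some $\mathcal I(i)$. Two processes $\mathcal I,\mathcal J:S\to\mathrm{fin}(\mathbb N)$ are equivalent if there is a bijection $\rho$ from the vertices of $\mathcal I$ onto the vertices of $\mathcal J$ such that $\mathcal J(i)=\rho(\mathcal I(i))$ (entrywise) for all $i\in S$. The edge-labeled network $\mathcal E_{\mathcal I}$ induced by $\mathcal I$ is its equivalence class, and $\mathfrak E_S$ is the set of all these networks. For $n\ge 1$, $\mathcal E_{\mathcal I}|_{[n]}:=\mathcal E_{\mathcal I|_{[n]}}$ is the restriction to the first $n$ edges, and $\mathfrak E_{\mathbb N}$ carries the $\sigma$-algebra generated by all the maps $\mathcal E\mapsto\mathcal E|_{[n]}$ into the discrete spaces $\mathfrak E_{[n]}$. For a permutation $\sigma$ of $\mathbb N$, $(\mathcal E_{\mathcal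 I})^\sigma:=\mathcal E_{\mathcal I\circ\sigma^{-1}}$. A random network $\mathcal Y\in\mathfrak E_{\mathbb N}$ is *edge exchangeable* if $\mathcal Y^\sigma$ and $\mathcal Y$ have the same law for every permutation $\sigma$ of $\mathbb N$. A network $\mathcal E_{\mathcal I}$ is *blip-free* if no $s\in\mathrm{fin}(\mathbb N)$ satisfies $\mathcal I(i)=s$ for exactly one $i$ (this does not depend on the representative $\mathcal I$). Let $$\mathcal F_1=\Bigl\{(f_s)_{s\in\mathrm{fin}(\mathbb N)}:\ f_s\ge 0,\ \sum_{s}f_s=1\Bigr\},$$ with the $\sigma$-algebra generated by the coordinates. For $f\in\mathcal F_1$ let $\varepsilon_f$ be the law on $\mathfrak E_{\mathbb N}$ of the network $\mathcal E_{\mathcal X}$ induced by $\mathcal X(i)=X_i$, where $X_1,X_2,\dots$ are i.i.d. with $\mathrm{pr}(X_i=s)=f_s$. **Theorem 4.2.** Let $\mathcal Y$ be a random element of $\mathfrak E_{\mathbb N}$ that is edge exchangeable and blip-free with probability $1$. Then there exists a probability measure $\phi$ on $\mathcal F_1$ such that $\mathcal Y\sim\varepsilon_\phi$, where $$\varepsilon_\phi(\cdot)=\int_{\mathcal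 F_1}\varepsilon_f(\cdot)\,\phi(df).$$ -/

import Mathlib

open MeasureTheory ProbabilityTheory

namespace EdgeExch

/-- `fin(ℕ)`: the finite ordered multisets of vertex labels, i.e. finite sequences
`(s₁, …, s_r)` of labels, repetitions allowed (a directed edge of arity `r`). -/
abbrev Interaction : Type := List ℕ

/-- The countable set `fin(ℕ)` carries the discrete σ-algebra. -/
instance : MeasurableSpace Interaction := ⊤

instance : DiscreteMeasurableSpace Interaction := ⟨fun _ => trivial⟩

/-- An interaction process `𝓘 : S → fin(ℕ)`. -/
abbrev InteractionProcess (S : Type*) : Type _ := S → Interaction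

variable {S T : Type*}

/-- The population members that take part in at least one interaction. -/
def participants (I : InteractionProcess S) : Set ℕ := {v | ∃ i, v ∈ I i}

/-- `J = ρ I` for a bijection `ρ` from the participants of `I` onto those of `J`. -/
def Equivalent (I J : InteractionProcess S) : Prop :=
  ∃ ρ : ℕ → ℕ, Set.BijOn ρ (participants I) (participants J) ∧ ∀ i, J i = (I i).map ρ

theorem Equivalent.refl (I : InteractionProcess S) : Equivalent I I :=
  ⟨id, Set.bijOn_id _, fun i => by simp⟩

theorem Equivalent.symm {I J : InteractionProcess S} (h : Equivalent I J) : Equivalent J I := by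
  obtain ⟨ρ, hρ, h⟩ := h
  have hinv := hρ.invOn_invFunOn
  refine ⟨Function.invFunOn ρ (participants I), hρ.symm hinv.symm, fun i => ?_⟩
  rw [h i, List.map_map]
  conv_lhs => rw [← List.map_id (I i)]
  exact List.map_congr_left fun v hv => (hinv.1 ⟨i, hv⟩).symm

theorem Equivalent.trans {I J K : InteractionProcess S} (h : Equivalent I J)
    (h' : Equivalent J K) : Equivalent I K := by
  obtain ⟨ρ, hρ, h⟩ := h
  obtain ⟨τ, hτ, h'⟩ := h'
  exact ⟨τ ∘ ρ, hτ.comp hρ, fun i => by rw [h' i, h i, List.map_map]⟩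

instance processSetoid (S : Type*) : Setoid (InteractionProcess S) :=
  ⟨Equivalent, Equivalent.refl, Equivalent.symm, Equivalent.trans⟩

/-- `𝔈_S`: networks with edges labeled by `S`, that is, interaction processes on `S` up to
bijective relabeling of the vertices. -/
def EdgeNetwork (S : Type*) : Type _ := Quotient (processSetoid S)

/-- The edge-labeled network induced by an interaction process. -/
def network (I : InteractionProcess S) : EdgeNetwork S := Quotient.mk (processSetoid S) I

theorem Equivalent.comp {I J : InteractionProcess S} (h : Equivalent I J) (g : T → S) :
    Equivalent (I ∘ g) (J ∘ g) := by
  obtain ⟨ρ, hρ, h⟩ := h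
  refine ⟨ρ, ⟨?_, ?_, ?_⟩, fun i => h (g i)⟩
  · rintro v ⟨i, hv⟩
    exact ⟨i, by simpa [h] using ⟨v, hv, rfl⟩⟩
  · refine hρ.injOn.mono ?_
    rintro v ⟨i, hv⟩
    exact ⟨g i, hv⟩
  · rintro w ⟨i, hw⟩
    obtain ⟨v, hv, rfl⟩ := List.mem_map.1 (show w ∈ (I (g i)).map ρ from h (g i) ▸ hw)
    exact ⟨v, ⟨i, hv⟩, rfl⟩

/-- A blip of a process is an interaction that occurs exactly once. -/
def IsBlip (I : InteractionProcess S) (s : Interaction) : Prop := ∃! i, I i = s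

namespace EdgeNetwork

/-- Pull back the edge labels along `g : T → S`: the edge labeled `t` in the new network is the
edge labeled `g t` in the old one. -/
def reindex (g : T → S) : EdgeNetwork S → EdgeNetwork T :=
  Quotient.map (fun I => I ∘ g) fun _ _ h => Equivalent.comp h g

/-- The restriction of a network to its first `n` edges. -/
def restrict (n : ℕ) : EdgeNetwork ℕ → EdgeNetwork (Fin n) := reindex Fin.val

/-- `𝓔^σ`, induced by the process `I^σ(i) = I(σ⁻¹(i))`. -/
def relabel (σ : Equiv.Perm S) : EdgeNetwork S → EdgeNetwork S := reindex ⇑(σ⁻¹)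

/-- The σ-algebra on `𝔈_ℕ` generated by the restrictions to finitely many edges, i.e. the Borel
σ-algebra of the metric `1 / (1 + sup {n | 𝓔|[n] = 𝓔'|[n]})`. -/
instance : MeasurableSpace (EdgeNetwork ℕ) :=
  ⨆ n : ℕ, MeasurableSpace.comap (restrict n) ⊤

/-- A network is blip-free if the processes inducing it have no blips. -/
def BlipFree : EdgeNetwork S → Prop :=
  Quotient.lift (fun I => ∀ s, ¬ IsBlip I s) <| by
    have key : ∀ I J : InteractionProcess S, Equivalent I J →
        (∀ s, ¬ IsBlip I s) → ∀ s, ¬ IsBlip J s := by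
      rintro I J ⟨ρ, -, h⟩ hI s ⟨i, hi, huniq⟩
      refine hI (I i) ⟨i, rfl, fun j hj => huniq j ?_⟩
      change J j = s
      rw [← hi, h i, h j]
      exact congrArg _ hj
    exact fun I J h => propext ⟨key I J h, key J I (Equivalent.symm h)⟩

end EdgeNetwork

theorem measurable_network : Measurable (network : InteractionProcess ℕ → EdgeNetwork ℕ) := by
  refine measurable_iff_comap_le.2 ?_
  simp only [EdgeNetwork.instMeasurableSpaceNat, MeasurableSpace.comap_iSup,
    MeasurableSpace.comap_comp]
  refine iSup_le fun n => ?_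
  have h : EdgeNetwork.restrict n ∘ network
      = (network : InteractionProcess (Fin n) → _) ∘ fun I i => I i.val := rfl
  rw [h, ← MeasurableSpace.comap_comp]
  refine (MeasurableSpace.comap_mono le_top).trans (Measurable.comap_le (m₂ := ⊤) ?_)
  have : @Measurable _ _ MeasurableSpace.pi MeasurableSpace.pi
      (fun (I : InteractionProcess ℕ) (i : Fin n) => I i.val) := by fun_prop
  intro s _
  exact this (Set.to_countable s).measurableSet

theorem EdgeNetwork.measurable_relabel (σ : Equiv.Perm ℕ) :
    Measurable (EdgeNetwork.relabel σ) := by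
  refine measurable_iff_comap_le.2 ?_
  simp only [EdgeNetwork.instMeasurableSpaceNat, MeasurableSpace.comap_iSup,
    MeasurableSpace.comap_comp]
  refine iSup_le fun n => ?_
  obtain ⟨m, hm⟩ : ∃ m : ℕ, ∀ i : Fin n, σ⁻¹ i.val < m :=
    ⟨(Finset.univ.sup fun i : Fin n => σ⁻¹ i.val) + 1, fun i =>
      Nat.lt_succ_of_le (Finset.le_sup (f := fun i : Fin n => σ⁻¹ i.val) (Finset.mem_univ i))⟩
  have h : EdgeNetwork.restrict n ∘ EdgeNetwork.relabel σ
      = EdgeNetwork.reindex (fun i : Fin n => (⟨σ⁻¹ i.val, hm i⟩ : Fin m))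
        ∘ EdgeNetwork.restrict m := by
    funext E
    induction E using Quotient.inductionOn with
    | h I => rfl
  rw [h, ← MeasurableSpace.comap_comp]
  exact (MeasurableSpace.comap_mono le_top).trans
    (le_iSup (fun n => MeasurableSpace.comap (EdgeNetwork.restrict n) ⊤) m)

/-- A random network is edge exchangeable if its law is invariant under every permutation of the
edge labels. -/
def EdgeExchangeable {Ω : Type*} [MeasurableSpace Ω] (P : Measure Ω) (Y : Ω → EdgeNetwork ℕ) :
    Prop :=
  ∀ σ : Equiv.Perm ℕ, IdentDistrib (fun ω => (Y ω).relabel σ) Y P P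

/-- The `fin(ℕ)`-simplex `𝓕₁`. -/
def Simplex : Type := {f : Interaction → ℝ // (∀ s, 0 ≤ f s) ∧ HasSum f 1}

/-- The σ-algebra on `𝓕₁` generated by the coordinates `f ↦ f_s`. -/
instance : MeasurableSpace Simplex := Subtype.instMeasurableSpace

namespace Simplex

/-- The distribution `pr(X = s) = f_s` on `fin(ℕ)`. -/
noncomputable def toPMF (f : Simplex) : PMF Interaction :=
  ⟨fun s => ENNReal.ofReal (f.1 s), by
    have h := ENNReal.ofReal_tsum_of_nonneg f.2.1 f.2.2.summable
    rw [f.2.2.tsum_eq, ENNReal.ofReal_one] at h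
    exact h ▸ ENNReal.summable.hasSum⟩

/-- The law of i.i.d. interactions `X₁, X₂, …` with distribution `f`. -/
noncomputable def iidLaw (f : Simplex) : Measure (InteractionProcess ℕ) :=
  Measure.infinitePi fun _ : ℕ => f.toPMF.toMeasure

/-- `ε_f`: the law of the network induced by i.i.d. interactions with distribution `f`. -/
noncomputable def networkLaw (f : Simplex) : Measure (EdgeNetwork ℕ) :=
  f.iidLaw.map network

theorem measurable_toMeasure_apply (A : Set Interaction) :
    Measurable fun f : Simplex => f.toPMF.toMeasure A := by
  have h : ∀ f : Simplex, f.toPMF.toMeasure A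
      = ∑' s, A.indicator (fun s => ENNReal.ofReal (f.1 s)) s :=
    fun f => PMF.toMeasure_apply _ MeasurableSet.of_discrete
  simp only [h]
  refine Measurable.tsum fun s => ?_
  by_cases hs : s ∈ A
  · simp only [Set.indicator_of_mem hs]
    exact ((measurable_pi_apply s).comp measurable_subtype_coe).ennreal_ofReal
  · simp [Set.indicator_of_notMem hs]

theorem measurable_iidLaw : Measurable iidLaw := by
  have : ∀ f, IsProbabilityMeasure (iidLaw f) := fun f => by unfold iidLaw; infer_instance
  refine Measurable.measure_of_isPiSystem_of_isProbabilityMeasure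
    (generateFrom_squareCylinders (α := fun _ : ℕ => Interaction)).symm
    (isPiSystem_squareCylinders (fun _ => MeasurableSpace.isPiSystem_measurableSet)
      (fun _ => Set.mem_ofPred.2 MeasurableSet.univ)) ?_
  rintro _ ⟨s, t, -, rfl⟩
  have h : ∀ f, iidLaw f ((s : Set ℕ).pi t) = ∏ i ∈ s, f.toPMF.toMeasure (t i) :=
    fun f => Measure.infinitePi_pi _ fun _ _ => MeasurableSet.of_discrete
  simp only [h]
  exact Finset.measurable_prod _ fun i _ => measurable_toMeasure_apply _

theorem measurable_networkLaw : Measurable networkLaw :=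
  (Measure.measurable_map _ measurable_network).comp measurable_iidLaw

end Simplex

/-- `ε_φ(·) = ∫ ε_f(·) φ(df)`. -/
noncomputable def mixtureLaw (φ : Measure Simplex) : Measure (EdgeNetwork ℕ) :=
  φ.bind Simplex.networkLaw

theorem mixtureLaw_apply (φ : Measure Simplex) {A : Set (EdgeNetwork ℕ)} (hA : MeasurableSet A) :
    mixtureLaw φ A = ∫⁻ f, f.networkLaw A ∂φ :=
  Measure.bind_apply hA Simplex.measurable_networkLaw.aemeasurable

end EdgeExch

/-! ### Canonical measurable representatives -/

namespace EdgeExch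

/-! Name every vertex after the place of its first occurrence. This picks a measurable
representative `rep` of each network. The sequence of its edges need not be exchangeable, because
the names depend on the order of the edges. The coincidence pattern "edges `i` and `j` are equal"
does not depend on names, so its law is invariant under all permutations, and so is the law of the
network on any `n` distinct edges.

For fixed `i`, exchangeability makes the indicators of `rep j = rep i` (with `j > i`) have constant
second and mixed moments. An L² estimate then gives almost sure limiting frequencies along `4 ^ k`
(`ae_tendsto_empirical`). Their sum is at most 1 by Fatou. Blip-freeness makes it almost surely 1:
each edge has a duplicate, so no mass is lost to edges seen only once (`measure_coincidence_le`,
`ae_tsum_frequency_eq_one`).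

The mixing measure is the law of the frequencies. Sampling `n` edges i.i.d. from the empirical
distribution of the first `N` edges means choosing `n` indices with replacement. These are distinct
up to vanishing probability, and then give the law of the first `n` edges. Fatou therefore bounds
the mixture by the original law on every event about finitely many edges
(`lintegral_tsum_prod_frequency_le`). Both are probability measures, so passing to complements turns
the inequality into equality. -/

theorem _root_.List.idxOf_map_of_injOn {α β : Type*} [DecidableEq α] [DecidableEq β] (f : α → β)
    (a : α) : ∀ l : List α, (∀ b ∈ l, f b = f a → b = a) → (l.map f).idxOf (f a) = l.idxOf a
  | [], _ => rfl
  | b :: l, h => by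
    have ih := List.idxOf_map_of_injOn f a l fun c hc => h c (List.mem_cons_of_mem _ hc)
    by_cases hb : b = a
    · subst hb; simp
    · have hfb : f b ≠ f a := fun h' => hb (h b List.mem_cons_self h')
      rw [List.map_cons, List.idxOf_cons_ne _ hfb, List.idxOf_cons_ne _ hb, ih]

/-- The first edge in which the vertex `v` takes part. -/
noncomputable def firstEdge (I : InteractionProcess ℕ) (v : ℕ) : ℕ := sInf {i | v ∈ I i}

/-- The position of the first occurrence of the vertex `v`. -/
noncomputable def birth (I : InteractionProcess ℕ) (v : ℕ) : ℕ :=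
  Nat.pair (firstEdge I v) ((I (firstEdge I v)).idxOf v)

/-- The process in which every vertex is named after its first occurrence. -/
noncomputable def canonical (I : InteractionProcess ℕ) : InteractionProcess ℕ :=
  fun i => (I i).map (birth I)

theorem mem_firstEdge {I : InteractionProcess ℕ} {v : ℕ} (hv : v ∈ participants I) :
    v ∈ I (firstEdge I v) := Nat.sInf_mem (s := {i | v ∈ I i}) hv

theorem firstEdge_le {I : InteractionProcess ℕ} {v i : ℕ} (hv : v ∈ I i) : firstEdge I v ≤ i :=
  Nat.sInf_le hv

theorem injOn_birth (I : InteractionProcess ℕ) : Set.InjOn (birth I) (participants I) := by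
  intro v hv w hw h
  obtain ⟨h1, h2⟩ := Nat.pair_eq_pair.1 h
  rw [← h1] at h2
  exact (List.idxOf_inj (mem_firstEdge hv)).1 h2

theorem participants_canonical (I : InteractionProcess ℕ) :
    participants (canonical I) = birth I '' participants I := by
  ext w
  simp only [participants, canonical, List.mem_map, Set.mem_ofPred_eq, Set.mem_image]
  constructor
  · rintro ⟨i, v, hv, rfl⟩
    exact ⟨v, ⟨i, hv⟩, rfl⟩
  · rintro ⟨v, ⟨i, hv⟩, rfl⟩
    exact ⟨i, v, hv, rfl⟩

theorem network_canonical (I : InteractionProcess ℕ) : network (canonical I) = network I :=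
  (Quotient.sound (s := processSetoid ℕ) ⟨birth I, by
    exact participants_canonical I ▸ (injOn_birth I).bijOn_image, fun _ => rfl⟩).symm

/-- A vertex of edge `i` first occurs in some edge of index at most `i`, and an injective renaming
changes neither that edge nor the position in it. This makes `rep` well defined on classes, and
measurable. -/
theorem canonical_eq_of_restrict {I J : InteractionProcess ℕ} {n i : ℕ} (hi : i < n)
    (h : Equivalent (fun k : Fin n => I k) (fun k : Fin n => J k)) :
    canonical I i = canonical J i := by
  obtain ⟨τ, hτ, h⟩ := h
  have hJ : ∀ k < n, J k = (I k).map τ := fun k hk => h ⟨k, hk⟩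
  have hinj : ∀ k < n, ∀ l < n, ∀ v ∈ I k, ∀ w ∈ I l, τ v = τ w → v = w :=
    fun k hk l hl v hv w hw e => hτ.injOn ⟨⟨k, hk⟩, hv⟩ ⟨⟨l, hl⟩, hw⟩ e
  unfold canonical
  rw [hJ i hi, List.map_map]
  refine List.map_congr_left fun v hv => ?_
  have hmem : ∀ k < n, (τ v ∈ J k ↔ v ∈ I k) := by
    intro k hk
    rw [hJ k hk, List.mem_map]
    exact ⟨fun ⟨w, hw, e⟩ => hinj k hk i hi w hw v hv e ▸ hw, fun hw => ⟨v, hw, rfl⟩⟩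
  have hvJ : τ v ∈ J i := (hmem i hi).2 hv
  have hfI := mem_firstEdge (I := I) ⟨i, hv⟩
  have hfJ := mem_firstEdge (I := J) ⟨i, hvJ⟩
  have hlI := (firstEdge_le hv).trans_lt hi
  have hlJ := (firstEdge_le hvJ).trans_lt hi
  have hfirst : firstEdge J (τ v) = firstEdge I v :=
    le_antisymm (firstEdge_le ((hmem _ hlI).2 hfI)) (firstEdge_le ((hmem _ hlJ).1 hfJ))
  simp only [Function.comp, birth]
  rw [hfirst, hJ _ hlI, List.idxOf_map_of_injOn]
  exact fun w hw e => hinj _ hlI i hi w hw v hv e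

/-- A representative of a network, chosen measurably. -/
noncomputable def EdgeNetwork.rep : EdgeNetwork ℕ → InteractionProcess ℕ :=
  Quotient.lift canonical fun I J h => by
    funext i
    exact canonical_eq_of_restrict (Nat.lt_succ_self i) (Equivalent.comp h Fin.val)

namespace EdgeNetwork

theorem network_rep (E : EdgeNetwork ℕ) : network E.rep = E := by
  induction E using Quotient.inductionOn with
  | h I => exact network_canonical I

theorem rep_eq_of_restrict_eq {E F : EdgeNetwork ℕ} {n i : ℕ} (hi : i < n)
    (h : E.restrict n = F.restrict n) : E.rep i = F.rep i := by
  induction E using Quotient.inductionOn with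
  | h I =>
  induction F using Quotient.inductionOn with
  | h J => exact canonical_eq_of_restrict hi (Quotient.exact h)

theorem measurableSet_restrict (n : ℕ) (A : Set (EdgeNetwork (Fin n))) :
    MeasurableSet (restrict n ⁻¹' A) :=
  le_iSup (fun n => MeasurableSpace.comap (restrict n) ⊤) n _ ⟨A, trivial, rfl⟩

theorem measurable_rep (i : ℕ) : Measurable fun E : EdgeNetwork ℕ => E.rep i := by
  intro s _
  -- Edge `i` of the representative is a function of the first `i + 1` edges, whose networks form a
  -- discrete space.
  convert measurableSet_restrict (i + 1) (restrict (i + 1) '' {E | E.rep i ∈ s}) using 1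
  ext E
  constructor
  · exact fun h => ⟨E, h, rfl⟩
  · rintro ⟨F, hF, h⟩
    show E.rep i ∈ s
    rw [← rep_eq_of_restrict_eq (Nat.lt_succ_self i) h]
    exact hF

/-- Reindexing changes the canonical names, but the two processes are renamings of each other, and a
renaming in either direction carries equal edges to equal edges. -/
theorem rep_reindex_eq_iff (g : ℕ → ℕ) (E : EdgeNetwork ℕ) (i j : ℕ) :
    (E.reindex g).rep i = (E.reindex g).rep j ↔ E.rep (g i) = E.rep (g j) := by
  have h : network (E.reindex g).rep = network (E.rep ∘ g) := by
    rw [network_rep]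
    conv_lhs => rw [← network_rep E]
    rfl
  obtain ⟨ρ, -, h₁⟩ := Quotient.exact h
  obtain ⟨τ, -, h₂⟩ := Quotient.exact h.symm
  constructor
  · intro e
    change (E.rep ∘ g) i = (E.rep ∘ g) j
    rw [h₁ i, h₁ j, e]
  · intro e
    rw [h₂ i, h₂ j]
    exact congrArg _ e

theorem reindex_eq_network {T : Type*} (g : T → ℕ) (E : EdgeNetwork ℕ) :
    E.reindex g = network (E.rep ∘ g) := by
  conv_lhs => rw [← network_rep E]
  rfl

theorem blipFree_iff (E : EdgeNetwork ℕ) :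
    E.BlipFree ↔ ∀ i, ∃ j, j ≠ i ∧ E.rep j = E.rep i := by
  have h : E.BlipFree ↔ ∀ s, ¬ IsBlip E.rep s := by
    conv_lhs => rw [← network_rep E]
    rfl
  rw [h]
  constructor
  · intro h i
    by_contra! hi
    exact h _ ⟨i, rfl, fun j hj => by_contra fun hji => hi j hji hj⟩
  · rintro h s ⟨i, rfl, hi⟩
    obtain ⟨j, hj, e⟩ := h i
    exact hj (hi j e)

end EdgeNetwork
end EdgeExch

/-! ### Convergence of averages from second moments -/

namespace EdgeExch
open Filter Topology

theorem integral_sum_mul_sum {Ω : Type*} [MeasurableSpace Ω] {μ : Measure Ω}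
    [IsProbabilityMeasure μ] {Z : ℕ → Ω → ℝ} (hm : ∀ j, Measurable (Z j))
    (h0 : ∀ j ω, 0 ≤ Z j ω) (h1 : ∀ j ω, Z j ω ≤ 1) {a b : ℝ} (ha : ∀ j, ∫ ω, Z j ω * Z j ω ∂μ = a)
    (hb : ∀ j k, j ≠ k → ∫ ω, Z j ω * Z k ω ∂μ = b) {N M : ℕ} (hNM : N ≤ M) :
    ∫ ω, (∑ j ∈ Finset.range N, Z j ω) * (∑ k ∈ Finset.range M, Z k ω) ∂μ
      = N * (a - b) + N * M * b := by
  have hint : ∀ j k, Integrable (fun ω => Z j ω * Z k ω) μ := fun j k =>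
    Integrable.of_bound ((hm j).mul (hm k)).aestronglyMeasurable 1 <| .of_forall fun ω => by
      rw [Real.norm_of_nonneg (mul_nonneg (h0 j ω) (h0 k ω))]
      exact mul_le_one₀ (h1 j ω) (h0 k ω) (h1 k ω)
  simp only [Finset.sum_mul_sum]
  rw [integral_finsetSum _ fun j _ => integrable_finsetSum _ fun k _ => hint j k]
  have h : ∀ j ∈ Finset.range N, ∫ ω, ∑ k ∈ Finset.range M, Z j ω * Z k ω ∂μ = a - b + M * b := by
    intro j hj
    rw [integral_finsetSum _ fun k _ => hint j k]
    have h' : ∀ k, ∫ ω, Z j ω * Z k ω ∂μ = (if j = k then a - b else 0) + b := by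
      intro k
      split_ifs with hjk
      · subst hjk; rw [ha]; ring
      · rw [hb j k hjk]; ring
    have hjM : j < M := (Finset.mem_range.1 hj).trans_le hNM
    simp [h', Finset.sum_add_distrib, hjM]
  rw [Finset.sum_congr rfl h]
  simp only [Finset.sum_const, Finset.card_range, nsmul_eq_mul]
  ring

/-- Expanding the square, the integral is exactly `(a - b) * (1 / N - 1 / M)`; here `a ≤ 1` and `b ≥
0`. -/
theorem integral_sq_average_sub_le {Ω : Type*} [MeasurableSpace Ω] {μ : Measure Ω}
    [IsProbabilityMeasure μ] {Z : ℕ → Ω → ℝ} (hm : ∀ j, Measurable (Z j))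
    (h0 : ∀ j ω, 0 ≤ Z j ω) (h1 : ∀ j ω, Z j ω ≤ 1) {a b : ℝ} (ha : ∀ j, ∫ ω, Z j ω * Z j ω ∂μ = a)
    (hb : ∀ j k, j ≠ k → ∫ ω, Z j ω * Z k ω ∂μ = b) {N M : ℕ} (hN : 0 < N) (hNM : N ≤ M) :
    ∫ ω, ((∑ j ∈ Finset.range N, Z j ω) / N - (∑ k ∈ Finset.range M, Z k ω) / M) ^ 2 ∂μ
      ≤ 1 / N := by
  have hM : 0 < M := hN.trans_le hNM
  have hN' : (0 : ℝ) < N := by exact_mod_cast hN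
  have hM' : (0 : ℝ) < M := by exact_mod_cast hM
  have hNM' : (N : ℝ) ≤ M := by exact_mod_cast hNM
  have hS : ∀ n, Measurable fun ω => ∑ j ∈ Finset.range n, Z j ω := fun n =>
    Finset.measurable_fun_sum _ fun j _ => hm j
  have hS0 : ∀ n ω, 0 ≤ ∑ j ∈ Finset.range n, Z j ω := fun n ω =>
    Finset.sum_nonneg fun j _ => h0 j ω
  have hS1 : ∀ n ω, ∑ j ∈ Finset.range n, Z j ω ≤ n := fun n ω => by
    simpa using Finset.sum_le_sum fun j (_ : j ∈ Finset.range n) => h1 j ω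
  have hint : ∀ n m, Integrable
      (fun ω => (∑ j ∈ Finset.range n, Z j ω) * (∑ j ∈ Finset.range m, Z j ω)) μ := fun n m =>
    Integrable.of_bound ((hS n).mul (hS m)).aestronglyMeasurable (n * m) <| .of_forall fun ω => by
      rw [Real.norm_of_nonneg (mul_nonneg (hS0 n ω) (hS0 m ω))]
      exact mul_le_mul (hS1 n ω) (hS1 m ω) (hS0 m ω) (Nat.cast_nonneg n)
  have hexp : ∀ ω, ((∑ j ∈ Finset.range N, Z j ω) / N - (∑ k ∈ Finset.range M, Z k ω) / M) ^ 2
      = (1 / N ^ 2 : ℝ) * ((∑ j ∈ Finset.range N, Z j ω) * (∑ j ∈ Finset.range N, Z j ω))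
      + (1 / M ^ 2 : ℝ) * ((∑ j ∈ Finset.range M, Z j ω) * (∑ j ∈ Finset.range M, Z j ω))
      - (2 / (N * M) : ℝ) * ((∑ j ∈ Finset.range N, Z j ω) * (∑ j ∈ Finset.range M, Z j ω)) := by
    intro ω
    field_simp
    ring
  have hprod : ∀ j k ω, 0 ≤ Z j ω * Z k ω := fun j k ω => mul_nonneg (h0 j ω) (h0 k ω)
  have hb0 : 0 ≤ b := hb 0 1 (by norm_num) ▸ integral_nonneg (hprod 0 1)
  have ha1 : a ≤ 1 := by
    rw [← ha 0]
    refine (integral_mono_of_nonneg (.of_forall (hprod 0 0)) (integrable_const (1 : ℝ))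
      (.of_forall fun ω => mul_le_one₀ (h1 0 ω) (h0 0 ω) (h1 0 ω))).trans (by simp)
  simp only [hexp]
  rw [integral_sub, integral_add, integral_const_mul, integral_const_mul, integral_const_mul,
    integral_sum_mul_sum hm h0 h1 ha hb le_rfl, integral_sum_mul_sum hm h0 h1 ha hb le_rfl,
    integral_sum_mul_sum hm h0 h1 ha hb hNM]
  · have h : (1 / N ^ 2 : ℝ) * (N * (a - b) + N * N * b) + (1 / M ^ 2 : ℝ) * (M * (a - b) + M * M * b)
        - (2 / (N * M) : ℝ) * (N * (a - b) + N * M * b) = (a - b) * (1 / N - 1 / M) := by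
      field_simp
      ring
    rw [h]
    have h2 : (1 : ℝ) / M ≤ 1 / N := one_div_le_one_div_of_le hN' hNM'
    have h3 : (0 : ℝ) < 1 / M := by positivity
    nlinarith
  all_goals first
    | exact (hint _ _).const_mul _
    | exact ((hint _ _).const_mul _).add ((hint _ _).const_mul _)

/-- Averages of a bounded sequence with constant second moments and constant mixed moments
converge almost everywhere along powers of four. -/
theorem ae_exists_tendsto_average {Ω : Type*} [MeasurableSpace Ω] {μ : Measure Ω}
    [IsProbabilityMeasure μ] {Z : ℕ → Ω → ℝ} (hm : ∀ j, Measurable (Z j))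
    (h0 : ∀ j ω, 0 ≤ Z j ω) (h1 : ∀ j ω, Z j ω ≤ 1) {a b : ℝ} (ha : ∀ j, ∫ ω, Z j ω * Z j ω ∂μ = a)
    (hb : ∀ j k, j ≠ k → ∫ ω, Z j ω * Z k ω ∂μ = b) :
    ∀ᵐ ω ∂μ, ∃ l, Tendsto (fun k : ℕ => (∑ j ∈ Finset.range (4 ^ k), Z j ω) / (4 ^ k : ℕ))
      atTop (𝓝 l) := by
  set A : ℕ → Ω → ℝ := fun k ω => (∑ j ∈ Finset.range (4 ^ k), Z j ω) / (4 ^ k : ℕ)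
  have hA : ∀ k, Measurable (A k) := fun k =>
    (Finset.measurable_fun_sum _ fun j _ => hm j).div_const _
  have hA0 : ∀ k ω, 0 ≤ A k ω := fun k ω =>
    div_nonneg (Finset.sum_nonneg fun j _ => h0 j ω) (Nat.cast_nonneg _)
  have hA1 : ∀ k ω, A k ω ≤ 1 := fun k ω => by
    refine div_le_one_of_le₀ ?_ (Nat.cast_nonneg _)
    simpa using Finset.sum_le_sum fun j (_ : j ∈ Finset.range (4 ^ k)) => h1 j ω
  have hd1 : ∀ k ω, |A k ω - A (k + 1) ω| ≤ 1 := fun k ω =>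
    abs_sub_le_iff.2 ⟨by linarith [hA1 k ω, hA0 (k + 1) ω], by linarith [hA0 k ω, hA1 (k + 1) ω]⟩
  have hdm : ∀ k, Measurable fun ω => |A k ω - A (k + 1) ω| := fun k =>
    ((hA k).sub (hA (k + 1))).abs
  have hdint : ∀ k, Integrable (fun ω => |A k ω - A (k + 1) ω|) μ := fun k =>
    Integrable.of_bound (hdm k).aestronglyMeasurable 1 <| .of_forall fun ω => by
      simpa using hd1 k ω
  have hsqint : ∀ k, Integrable (fun ω => (A k ω - A (k + 1) ω) ^ 2) μ := fun k =>
    Integrable.of_bound (((hA k).sub (hA (k + 1))).pow_const 2).aestronglyMeasurable 1 <|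
      .of_forall fun ω => by
        rw [Real.norm_of_nonneg (sq_nonneg _), ← sq_abs]
        exact pow_le_one₀ (abs_nonneg _) (hd1 k ω)
  have hbound : ∀ k, ∫ ω, |A k ω - A (k + 1) ω| ∂μ ≤ (1 / 2) ^ k := by
    intro k
    have hsq : ∫ ω, (A k ω - A (k + 1) ω) ^ 2 ∂μ ≤ (1 / 4) ^ k := by
      refine (integral_sq_average_sub_le hm h0 h1 ha hb (by positivity)
        (Nat.pow_le_pow_right (by norm_num) k.le_succ)).trans_eq ?_
      push_cast
      rw [one_div_pow]
    have h2 : (0 : ℝ) < 2 ^ k := by positivity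
    have h4 : (4 : ℝ) ^ k = 2 ^ k * 2 ^ k := by rw [← mul_pow]; norm_num
    calc ∫ ω, |A k ω - A (k + 1) ω| ∂μ
        ≤ ∫ ω, ((1 / 2) ^ k / 2 + 2 ^ k / 2 * (A k ω - A (k + 1) ω) ^ 2) ∂μ := by
          refine integral_mono (hdint k) ((integrable_const _).add ((hsqint k).const_mul _)) ?_
          intro ω
          -- This is `x ≤ 2⁻ᵏ / 2 + 2ᵏ x² / 2`, weighted so that the L² bound `4⁻ᵏ` becomes the L¹
          -- bound `2⁻ᵏ`, which is summable in `k`.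
          have := sq_nonneg (2 ^ k * |A k ω - A (k + 1) ω| - 1)
          beta_reduce
          rw [← sq_abs (A k ω - A (k + 1) ω)]
          simp only [one_div_pow]
          set x := |A k ω - A (k + 1) ω|
          have h : 1 / 2 ^ k / 2 + 2 ^ k / 2 * x ^ 2 - x = (2 ^ k * x - 1) ^ 2 / (2 * 2 ^ k) := by
            field_simp
            ring
          have h' : 0 ≤ (2 ^ k * x - 1) ^ 2 / (2 * 2 ^ k) := by positivity
          linarith
      _ = (1 / 2) ^ k / 2 + 2 ^ k / 2 * ∫ ω, (A k ω - A (k + 1) ω) ^ 2 ∂μ := by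
          rw [integral_add (integrable_const _) ((hsqint k).const_mul _), integral_const_mul]
          simp
      _ ≤ (1 / 2) ^ k / 2 + 2 ^ k / 2 * (1 / 4) ^ k := by gcongr
      _ = (1 / 2) ^ k := by
          simp only [one_div_pow, h4]
          field_simp
          ring
  have hfin : ∫⁻ ω, ∑' k, ENNReal.ofReal |A k ω - A (k + 1) ω| ∂μ ≠ ⊤ := by
    rw [lintegral_tsum fun k => (hdm k).ennreal_ofReal.aemeasurable]
    refine ne_top_of_le_ne_top ?_ (ENNReal.tsum_le_tsum (g := fun k => ENNReal.ofReal ((1 / 2) ^ k))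
      fun k => ?_)
    · rw [← ENNReal.ofReal_tsum_of_nonneg (fun k => by positivity) summable_geometric_two]
      exact ENNReal.ofReal_ne_top
    · rw [← ofReal_integral_eq_lintegral_ofReal (hdint k) (.of_forall fun ω => abs_nonneg _)]
      exact ENNReal.ofReal_le_ofReal (hbound k)
  filter_upwards [ae_lt_top' (Measurable.tsum fun k => (hdm k).ennreal_ofReal).aemeasurable hfin]
    with ω hω
  refine cauchySeq_tendsto_of_complete (cauchySeq_of_summable_dist ?_)
  have hs := ENNReal.summable_toReal hω.ne
  simpa [Real.dist_eq, A] using hs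

end EdgeExch

/-! ### Asymptotic edge frequencies -/

namespace EdgeExch
open Filter Topology
open scoped ENNReal

/-- The two sums differ by `c` terms at each end, which is negligible after division by `u k`. The
shift serves to discard the indices up to a fixed edge. -/
theorem tendsto_average_of_shift {z : ℕ → ℝ} (h0 : ∀ j, 0 ≤ z j) (h1 : ∀ j, z j ≤ 1) {c : ℕ}
    {u : ℕ → ℕ} (hu : Tendsto u atTop atTop) {l : ℝ}
    (h : Tendsto (fun k => (∑ j ∈ Finset.range (u k), z (c + j)) / (u k : ℝ)) atTop (𝓝 l)) :
    Tendsto (fun k => (∑ j ∈ Finset.range (u k), z j) / (u k : ℝ)) atTop (𝓝 l) := by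
  have hd : Tendsto (fun k => (∑ j ∈ Finset.range (u k), z j) / (u k : ℝ)
      - (∑ j ∈ Finset.range (u k), z (c + j)) / (u k : ℝ)) atTop (𝓝 0) := by
    refine squeeze_zero_norm (a := fun k => (c : ℝ) / u k) (fun k => ?_)
      (tendsto_const_nhds.div_atTop (tendsto_natCast_atTop_atTop.comp hu))
    rw [← sub_div, norm_div, Real.norm_natCast]
    refine div_le_div_of_nonneg_right ?_ (Nat.cast_nonneg _)
    have e := (Finset.sum_range_add z c (u k)).symm.trans
      ((congrArg (fun n => ∑ j ∈ Finset.range n, z j) (add_comm c (u k))).trans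
        (Finset.sum_range_add z (u k) c))
    have hb : ∀ y : ℕ → ℝ, (∀ j, 0 ≤ y j) → (∀ j, y j ≤ 1) →
        0 ≤ ∑ j ∈ Finset.range c, y j ∧ ∑ j ∈ Finset.range c, y j ≤ c := fun y hy0 hy1 =>
      ⟨Finset.sum_nonneg fun j _ => hy0 j, by
        simpa using Finset.sum_le_sum fun j (_ : j ∈ Finset.range c) => hy1 j⟩
    have b1 := hb z h0 h1
    have b2 := hb (fun j => z (u k + j)) (fun j => h0 _) (fun j => h1 _)
    rw [Real.norm_eq_abs, abs_sub_le_iff]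
    constructor <;> linarith [b1.1, b1.2, b2.1, b2.2]
  simpa using hd.add h

theorem exists_perm_apply_eq {n : ℕ} {x y : Fin n → ℕ} (hx : Function.Injective x)
    (hy : Function.Injective y) : ∃ σ : Equiv.Perm ℕ, ∀ k, σ (x k) = y k := by
  have := Equiv.Perm.isMultiplyPretransitive ℕ n
  obtain ⟨σ, h⟩ := MulAction.exists_smul_eq (Equiv.Perm ℕ) (⟨x, hx⟩ : Fin n ↪ ℕ) ⟨y, hy⟩
  exact ⟨σ, fun k => congrArg (fun e : Fin n ↪ ℕ => e k) h⟩

namespace EdgeNetwork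

/-- The proportion of the first `N` edges of the representative that equal `s`. -/
noncomputable def empirical (N : ℕ) (s : Interaction) (E : EdgeNetwork ℕ) : ℝ≥0∞ :=
  (∑ j ∈ Finset.range N, if E.rep j = s then 1 else 0) / N

/-- The asymptotic frequency of `s` in the representative. -/
noncomputable def frequency (s : Interaction) (E : EdgeNetwork ℕ) : ℝ≥0∞ :=
  liminf (fun k : ℕ => empirical (4 ^ k) s E) atTop

theorem measurable_empirical (N : ℕ) (s : Interaction) : Measurable (empirical N s) := by
  refine (Finset.measurable_fun_sum _ fun j _ => ?_).div_const _
  exact Measurable.ite (measurable_rep j (measurableSet_singleton s)) measurable_const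
    measurable_const

theorem measurable_frequency (s : Interaction) : Measurable (frequency s) :=
  Measurable.liminf fun _ => measurable_empirical _ _

theorem tsum_empirical {N : ℕ} (hN : N ≠ 0) (E : EdgeNetwork ℕ) :
    ∑' s, empirical N s E = 1 := by
  simp only [empirical, div_eq_mul_inv]
  rw [ENNReal.tsum_mul_right, Summable.tsum_finsetSum fun _ _ => ENNReal.summable]
  have h : ∀ j, ∑' s, (if E.rep j = s then 1 else 0 : ℝ≥0∞) = 1 := fun j => tsum_ite_eq' _ _
  simp only [h, Finset.sum_const, Finset.card_range, nsmul_eq_mul, mul_one]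
  exact ENNReal.mul_inv_cancel (by exact_mod_cast hN) (ENNReal.natCast_ne_top N)

/-- Fatou for the counting measure; mass may escape in the limit, so equality can fail. -/
theorem tsum_frequency_le_one (E : EdgeNetwork ℕ) : ∑' s, frequency s E ≤ 1 := by
  have h := lintegral_liminf_le (μ := (Measure.count : Measure Interaction)) (u := atTop)
    (f := fun (k : ℕ) s => empirical (4 ^ k) s E) fun _ => Measurable.of_discrete
  simp only [lintegral_count] at h
  refine h.trans_eq ?_
  simp [fun k : ℕ => tsum_empirical (N := 4 ^ k) (by positivity) E]

theorem frequency_ne_top (s : Interaction) (E : EdgeNetwork ℕ) : frequency s E ≠ ∞ :=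
  ne_top_of_le_ne_top ENNReal.one_ne_top ((ENNReal.le_tsum s).trans (tsum_frequency_le_one E))

/-! ### Consequences of exchangeability -/

section Invariant

variable {μ : Measure (EdgeNetwork ℕ)}

theorem measure_preimage_relabel (hμ : ∀ σ, μ.map (relabel σ) = μ) (σ : Equiv.Perm ℕ)
    {B : Set (EdgeNetwork ℕ)} (hB : MeasurableSet B) : μ (relabel σ ⁻¹' B) = μ B := by
  conv_rhs => rw [← hμ σ]
  rw [Measure.map_apply (measurable_relabel σ) hB]

theorem measure_preimage_reindex (hμ : ∀ σ, μ.map (relabel σ) = μ) {n : ℕ} {g : Fin n → ℕ}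
    (hg : Function.Injective g) (A : Set (EdgeNetwork (Fin n))) :
    μ (reindex g ⁻¹' A) = μ (restrict n ⁻¹' A) := by
  obtain ⟨τ, hτ⟩ := exists_perm_apply_eq Fin.val_injective hg
  rw [← measure_preimage_relabel hμ τ⁻¹ (measurableSet_restrict n A), ← Set.preimage_comp]
  congr 2
  funext E
  induction E using Quotient.inductionOn with
  | h I =>
    change network (I ∘ g) = network ((I ∘ ⇑((τ⁻¹ : Equiv.Perm ℕ)⁻¹)) ∘ Fin.val)
    congr 1
    funext k
    simp [hτ]

/-- This is the form of exchangeability available for `rep`: it covers events expressed through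
equality of edges only. -/
theorem measure_coincidence_perm (hμ : ∀ σ, μ.map (relabel σ) = μ) (τ : Equiv.Perm ℕ)
    (Q : (ℕ → ℕ → Prop) → Prop)
    (hQ : MeasurableSet {E : EdgeNetwork ℕ | Q fun i j => E.rep i = E.rep j}) :
    μ {E | Q fun i j => E.rep (τ i) = E.rep (τ j)} = μ {E | Q fun i j => E.rep i = E.rep j} := by
  rw [← measure_preimage_relabel hμ τ⁻¹ hQ]
  congr 1
  ext E
  simp only [Set.mem_ofPred_eq, Set.mem_preimage, relabel, inv_inv, rep_reindex_eq_iff]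

theorem measurableSet_rep_eq (i j : ℕ) :
    MeasurableSet {E : EdgeNetwork ℕ | E.rep i = E.rep j} :=
  measurableSet_eq_fun (measurable_rep i) (measurable_rep j)

theorem measurableSet_blipFree : MeasurableSet {E : EdgeNetwork ℕ | E.BlipFree} := by
  simp only [blipFree_iff]
  refine measurableSet_setOfPred.2 (Measurable.forall fun i => Measurable.exists fun j => ?_)
  exact measurable_const.and (measurableSet_setOfPred.1 (measurableSet_rep_eq j i))

theorem ae_exists_tendsto_average_rep [IsProbabilityMeasure μ]
    (hμ : ∀ σ, μ.map (relabel σ) = μ) (i : ℕ) :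
    ∀ᵐ E ∂μ, ∃ l, Tendsto (fun k : ℕ => (∑ j ∈ Finset.range (4 ^ k),
      if E.rep j = E.rep i then (1 : ℝ) else 0) / (4 ^ k : ℕ)) atTop (𝓝 l) := by
  set Z : ℕ → EdgeNetwork ℕ → ℝ := fun j E => if E.rep j = E.rep i then 1 else 0
  have hZ : ∀ j, Measurable (Z j) := fun j =>
    Measurable.ite (measurableSet_rep_eq j i) measurable_const measurable_const
  have h0 : ∀ j E, 0 ≤ Z j E := fun j E => by simp only [Z]; split_ifs <;> norm_num
  have h1 : ∀ j E, Z j E ≤ 1 := fun j E => by simp only [Z]; split_ifs <;> norm_num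
  have hprod : ∀ j k, ∫ E, Z j E * Z k E ∂μ
      = μ.real {E | E.rep j = E.rep i ∧ E.rep k = E.rep i} := by
    intro j k
    have hjk : MeasurableSet {E : EdgeNetwork ℕ | E.rep j = E.rep i ∧ E.rep k = E.rep i} :=
      (measurableSet_rep_eq j i).inter (measurableSet_rep_eq k i)
    rw [← integral_indicator_one hjk]
    refine integral_congr_ae (.of_forall fun E => ?_)
    simp only [Z, Set.indicator_apply, Set.mem_ofPred_eq, Pi.one_apply]
    split_ifs <;> simp_all
  -- The reference edge `i` must stay fixed, so only indices beyond `i` are used below and the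
  -- averages are shifted by `i + 1`.
  have hinv : ∀ (τ : Equiv.Perm ℕ) (j k : ℕ), τ i = i →
      ∫ E, Z (τ j) E * Z (τ k) E ∂μ = ∫ E, Z j E * Z k E ∂μ := by
    intro τ j k hi
    have h := measure_coincidence_perm hμ τ (fun R => R j i ∧ R k i)
      ((measurableSet_rep_eq j i).inter (measurableSet_rep_eq k i))
    simp only [hi] at h
    rw [hprod, hprod, measureReal_def, measureReal_def, h]
  have ha : ∀ j, ∫ E, Z (i + 1 + j) E * Z (i + 1 + j) E ∂μ
      = ∫ E, Z (i + 1) E * Z (i + 1) E ∂μ := by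
    intro j
    have h := hinv (Equiv.swap (i + 1) (i + 1 + j)) (i + 1) (i + 1)
      (Equiv.swap_apply_of_ne_of_ne (by omega) (by omega))
    simpa only [Equiv.swap_apply_left] using h
  have hb : ∀ j k, j ≠ k → ∫ E, Z (i + 1 + j) E * Z (i + 1 + k) E ∂μ
      = ∫ E, Z (i + 1) E * Z (i + 2) E ∂μ := by
    intro j k hjk
    have hx : Function.Injective ![i, i + 1, i + 2] := by
      intro a b
      fin_cases a <;> fin_cases b <;> simp
    have hy : Function.Injective ![i, i + 1 + j, i + 1 + k] := by
      intro a b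
      fin_cases a <;> fin_cases b <;> simp <;> omega
    obtain ⟨τ, hτ⟩ := exists_perm_apply_eq hx hy
    have e0 : τ i = i := hτ 0
    have e1 : τ (i + 1) = i + 1 + j := hτ 1
    have e2 : τ (i + 2) = i + 1 + k := hτ 2
    rw [← e1, ← e2]
    exact hinv τ _ _ e0
  filter_upwards [ae_exists_tendsto_average (fun j => hZ (i + 1 + j)) (fun j => h0 _)
    (fun j => h1 _) ha hb] with E ⟨l, hl⟩
  exact ⟨l, tendsto_average_of_shift (z := fun j => Z j E) (c := i + 1) (u := fun k => 4 ^ k)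
    (fun j => h0 j E) (fun j => h1 j E) (tendsto_pow_atTop_atTop_of_one_lt (by norm_num)) hl⟩

theorem empirical_eq_ofReal {N : ℕ} (hN : N ≠ 0) (s : Interaction) (E : EdgeNetwork ℕ) :
    empirical N s E
      = ENNReal.ofReal ((∑ j ∈ Finset.range N, if E.rep j = s then (1 : ℝ) else 0) / N) := by
  rw [empirical, ENNReal.ofReal_div_of_pos (by positivity), ENNReal.ofReal_natCast,
    ENNReal.ofReal_sum_of_nonneg fun j _ => by split_ifs <;> norm_num]
  congr 1
  refine Finset.sum_congr rfl fun j _ => ?_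
  split_ifs <;> simp

/-- Either `s` is some edge `rep i`, and countably many null sets suffice for all `i`, or `s` never
occurs and its frequency is 0. -/
theorem ae_tendsto_empirical [IsProbabilityMeasure μ] (hμ : ∀ σ, μ.map (relabel σ) = μ) :
    ∀ᵐ E ∂μ, ∀ s, Tendsto (fun k : ℕ => empirical (4 ^ k) s E) atTop (𝓝 (frequency s E)) := by
  filter_upwards [ae_all_iff.2 fun i => ae_exists_tendsto_average_rep hμ i] with E hE s
  suffices h : ∃ l, Tendsto (fun k : ℕ => empirical (4 ^ k) s E) atTop (𝓝 l) by
    obtain ⟨l, hl⟩ := h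
    rwa [frequency, hl.liminf_eq]
  by_cases hs : ∃ i, E.rep i = s
  · obtain ⟨i, rfl⟩ := hs
    obtain ⟨l, hl⟩ := hE i
    refine ⟨ENNReal.ofReal l, ?_⟩
    simp only [fun k : ℕ => empirical_eq_ofReal (N := 4 ^ k) (by positivity) (E.rep i) E]
    exact ENNReal.tendsto_ofReal hl
  · push Not at hs
    exact ⟨0, by simp [empirical, hs]⟩

/-- By symmetry the left side is the probability that edge `m` repeats one of the first `m` edges,
which is at most the probability that edge `j` does, for every `j`. Averaging over `j < N` gives the
expected empirical mass of the values of the first `m` edges. That set of values is finite, so its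
mass passes to the limit. -/
theorem measure_coincidence_le [IsProbabilityMeasure μ] (hμ : ∀ σ, μ.map (relabel σ) = μ)
    (m : ℕ) : μ {E | ∃ i < m, E.rep (i + 1) = E.rep 0} ≤ ∫⁻ E, ∑' s, frequency s E ∂μ := by
  classical
  have hmeas : ∀ j, MeasurableSet {E : EdgeNetwork ℕ | ∃ i < m, E.rep i = E.rep j} := by
    intro j
    have : {E : EdgeNetwork ℕ | ∃ i < m, E.rep i = E.rep j}
        = ⋃ i ∈ Finset.range m, {E : EdgeNetwork ℕ | E.rep i = E.rep j} := by ext E; simp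
    rw [this]
    exact Finset.measurableSet_biUnion _ fun i _ => measurableSet_rep_eq i j
  have hfst : μ {E | ∃ i < m, E.rep (i + 1) = E.rep 0} = μ {E | ∃ i < m, E.rep i = E.rep m} := by
    -- The permutation sends `k` to `k + 1` for `k < m`, and `m` to `0`.
    obtain ⟨τ, hτ⟩ := exists_perm_apply_eq (n := m + 1) (x := Fin.val)
      (y := fun k : Fin (m + 1) => if (k : ℕ) < m then (k : ℕ) + 1 else 0) Fin.val_injective (by
        intro a b h
        ext
        have := a.2
        have := b.2
        dsimp only at h
        split_ifs at h <;> omega)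
    have h1 : ∀ i < m, τ i = i + 1 := fun i hi => by simpa [hi] using hτ ⟨i, by omega⟩
    have h2 : τ m = 0 := by simpa using hτ ⟨m, by omega⟩
    rw [← measure_coincidence_perm hμ τ (fun R => ∃ i < m, R i m) (hmeas m)]
    congr 1
    ext E
    simp only [Set.mem_ofPred_eq, h2]
    exact exists_congr fun i => and_congr_right fun hi => by rw [h1 i hi]
  have hle : ∀ j, μ {E | ∃ i < m, E.rep i = E.rep m} ≤ μ {E | ∃ i < m, E.rep i = E.rep j} := by
    intro j
    by_cases hj : j < m
    -- For `j < m` the event on the right is certain, with `i = j`.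
    · refine prob_le_one.trans_eq ?_
      rw [← measure_univ (μ := μ)]
      congr 1
      ext E
      simpa using ⟨j, hj, rfl⟩
    · have h := measure_coincidence_perm hμ (Equiv.swap m j) (fun R => ∃ i < m, R i m) (hmeas m)
      simp only [Equiv.swap_apply_left] at h
      rw [← h]
      refine measure_mono fun E => ?_
      rintro ⟨i, hi, e⟩
      exact ⟨i, hi, by rwa [Equiv.swap_apply_of_ne_of_ne (by omega) (by omega)] at e⟩
  have hsum : ∀ N E, ∑ s ∈ (Finset.range m).image (EdgeNetwork.rep E), empirical N s E
      = (∑ j ∈ Finset.range N, if ∃ i < m, E.rep i = E.rep j then 1 else 0) / N := by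
    intro N E
    simp only [empirical, div_eq_mul_inv]
    rw [← Finset.sum_mul, Finset.sum_comm]
    congr 1
    refine Finset.sum_congr rfl fun j _ => ?_
    rw [Finset.sum_ite_eq]
    simp
  have hlim : Tendsto (fun k : ℕ => ∫⁻ E, ∑ s ∈ (Finset.range m).image (EdgeNetwork.rep E),
        empirical (4 ^ k) s E ∂μ) atTop
      (𝓝 (∫⁻ E, ∑ s ∈ (Finset.range m).image (EdgeNetwork.rep E), frequency s E ∂μ)) := by
    refine tendsto_lintegral_of_dominated_convergence (fun _ => 1) (fun k => ?_) (fun k => ?_)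
      (by simp) ?_
    · simp only [hsum]
      exact (Finset.measurable_fun_sum _ fun j _ =>
        Measurable.ite (hmeas j) measurable_const measurable_const).div_const _
    · exact .of_forall fun E => (ENNReal.sum_le_tsum _).trans_eq (tsum_empirical (by positivity) E)
    · filter_upwards [ae_tendsto_empirical hμ] with E hE
      exact tendsto_finsetSum _ fun s _ => hE s
  rw [hfst]
  refine (ge_of_tendsto' hlim fun k => ?_).trans
    (lintegral_mono fun E => ENNReal.sum_le_tsum _)
  simp only [hsum]
  have hN : ((4 ^ k : ℕ) : ℝ≥0∞) ≠ 0 := by positivity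
  simp only [div_eq_mul_inv]
  rw [lintegral_mul_const' _ _ (ENNReal.inv_ne_top.2 hN), lintegral_finsetSum _ fun j _ =>
    Measurable.ite (hmeas j) measurable_const measurable_const, ← div_eq_mul_inv,
    ENNReal.le_div_iff_mul_le (.inl hN) (.inl (ENNReal.natCast_ne_top _))]
  have hind : ∀ j, ∫⁻ E, (if ∃ i < m, E.rep i = E.rep j then 1 else 0 : ℝ≥0∞) ∂μ
      = μ {E | ∃ i < m, E.rep i = E.rep j} := by
    intro j
    rw [← lintegral_indicator_one (hmeas j)]
    refine lintegral_congr fun E => ?_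
    simp [Set.indicator_apply]
  simp only [hind]
  refine le_trans ?_ (Finset.sum_le_sum fun j _ => hle j)
  simp [mul_comm]

theorem ae_tsum_frequency_eq_one [IsProbabilityMeasure μ] (hμ : ∀ σ, μ.map (relabel σ) = μ)
    (hblip : ∀ᵐ E ∂μ, E.BlipFree) : ∀ᵐ E ∂μ, ∑' s, frequency s E = 1 := by
  have hmono : Monotone fun m : ℕ => {E : EdgeNetwork ℕ | ∃ i < m, E.rep (i + 1) = E.rep 0} :=
    fun m m' h E ⟨i, hi, e⟩ => ⟨i, hi.trans_le h, e⟩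
  have hone : μ (⋃ m : ℕ, {E : EdgeNetwork ℕ | ∃ i < m, E.rep (i + 1) = E.rep 0}) = 1 := by
    refine (measure_eq_measure_of_null_sdiff (Set.subset_univ _) ?_).trans measure_univ
    rw [Set.sdiff_eq, Set.univ_inter, ← mem_ae_iff]
    filter_upwards [hblip] with E hE
    obtain ⟨j, hj, e⟩ := (blipFree_iff E).1 hE 0
    obtain ⟨i, rfl⟩ := Nat.exists_eq_succ_of_ne_zero hj
    exact Set.mem_iUnion.2 ⟨i + 1, i, i.lt_succ_self, e⟩
  -- An integrand bounded by 1 with integral at least 1 is almost surely 1.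
  have hint : (1 : ℝ≥0∞) ≤ ∫⁻ E, ∑' s, frequency s E ∂μ := by
    rw [← hone, hmono.measure_iUnion]
    exact iSup_le fun m => measure_coincidence_le hμ m
  refine ae_eq_of_ae_le_of_lintegral_le (g := fun _ => 1) (.of_forall tsum_frequency_le_one) ?_
    aemeasurable_const (by simpa using hint)
  exact ne_top_of_le_ne_top ENNReal.one_ne_top
    ((lintegral_mono tsum_frequency_le_one).trans (by simp))

end Invariant
end EdgeNetwork
end EdgeExch

/-! ### Sampling with replacement and the bound on the mixture -/

namespace EdgeExch
open Filter Topology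
open scoped ENNReal

theorem tendsto_card_not_injective_div (n : ℕ) {u : ℕ → ℕ} (hu : Tendsto u atTop atTop) :
    Tendsto (fun k => (Fintype.card {g : Fin n → Fin (u k) // ¬ Function.Injective g} : ℝ≥0∞)
      / ((u k : ℝ≥0∞) ^ n)) atTop (𝓝 0) := by
  have hreal : Tendsto (fun N : ℕ => 1 - (N.descFactorial n : ℝ) / (N : ℝ) ^ n) atTop (𝓝 0) := by
    have h := (Asymptotics.isEquivalent_iff_tendsto_one (by
      filter_upwards [eventually_gt_atTop 0] with N hN
      positivity)).1 (isEquivalent_descFactorial n)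
    simpa using h.const_sub 1
  have h := (ENNReal.tendsto_ofReal hreal).comp hu
  rw [ENNReal.ofReal_zero] at h
  refine h.congr' ?_
  filter_upwards [hu.eventually_gt_atTop 0] with k hk
  have hcard : Fintype.card {g : Fin n → Fin (u k) // ¬ Function.Injective g}
      = u k ^ n - (u k).descFactorial n := by
    rw [Fintype.card_subtype_compl, Fintype.card_congr
      (Equiv.subtypeInjectiveEquivEmbedding (Fin n) (Fin (u k))), Fintype.card_embedding_eq]
    simp
  have hpos : (0 : ℝ) < (u k : ℝ) ^ n := by positivity
  rw [hcard, Function.comp_apply, one_sub_div hpos.ne', ENNReal.ofReal_div_of_pos hpos,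
    ENNReal.ofReal_pow (Nat.cast_nonneg _), ENNReal.ofReal_natCast]
  congr 1
  rw [← ENNReal.ofReal_natCast, Nat.cast_sub (Nat.descFactorial_le_pow _ _)]
  push_cast
  rfl

namespace EdgeNetwork

/-- Expanding the product of empirical frequencies gives a sum over all choices `g` of `n` indices
below `N`, and each `g` contributes to the single tuple `t` of edges that it selects. -/
theorem tsum_indicator_prod_empirical (N n : ℕ) (A : Set (EdgeNetwork (Fin n)))
    (E : EdgeNetwork ℕ) :
    ∑' t : Fin n → Interaction, (network ⁻¹' A).indicator (fun t => ∏ k, empirical N (t k) E) t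
      = (∑ g : Fin n → Fin N, (reindex (fun k => (g k : ℕ)) ⁻¹' A).indicator 1 E)
        / (N : ℝ≥0∞) ^ n := by
  have hprod : ∀ t : Fin n → Interaction, ∏ k, empirical N (t k) E
      = (∑ g : Fin n → Fin N, if (fun k => E.rep (g k)) = t then 1 else 0)
        / (N : ℝ≥0∞) ^ n := by
    intro t
    simp only [empirical, div_eq_mul_inv, ← Fin.sum_univ_eq_sum_range
      (fun j => if E.rep j = _ then (1 : ℝ≥0∞) else 0)]
    rw [Finset.prod_mul_distrib, Finset.prod_univ_sum, Fintype.piFinset_univ]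
    congr 1
    · refine Finset.sum_congr rfl fun g _ => ?_
      rw [Finset.prod_ite_zero]
      simp [funext_iff]
    · simp [ENNReal.inv_pow]
  have hterm : ∀ t : Fin n → Interaction,
      (network ⁻¹' A).indicator (fun t => ∏ k, empirical N (t k) E) t
      = (∑ g : Fin n → Fin N, if t = (fun k => E.rep (g k)) then
          (reindex (fun k => (g k : ℕ)) ⁻¹' A).indicator 1 E else 0) * ((N : ℝ≥0∞) ^ n)⁻¹ := by
    intro t
    have hg : ∀ g : Fin n → Fin N, (fun k => E.rep (g k)) = t →
        (E.reindex (fun k => (g k : ℕ)) ∈ A ↔ network t ∈ A) := by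
      rintro g rfl
      rw [reindex_eq_network]
      rfl
    by_cases ht : network t ∈ A
    · rw [Set.indicator_of_mem (Set.mem_preimage.2 ht), hprod, div_eq_mul_inv]
      congr 1
      refine Finset.sum_congr rfl fun g _ => ?_
      by_cases e : (fun k => E.rep (g k)) = t
      · simp [e, (hg g e).2 ht]
      · simp [e, Ne.symm e]
    · rw [Set.indicator_of_notMem (by simpa using ht), Finset.sum_eq_zero, zero_mul]
      intro g _
      by_cases e : (fun k => E.rep (g k)) = t
      · simp [e, mt (hg g e).1 ht]
      · simp [Ne.symm e]
  rw [tsum_congr hterm, ENNReal.tsum_mul_right, div_eq_mul_inv,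
    Summable.tsum_finsetSum fun _ _ => ENNReal.summable]
  simp only [tsum_ite_eq]

theorem measurableSet_preimage_reindex {n N : ℕ} (g : Fin n → Fin N)
    (A : Set (EdgeNetwork (Fin n))) :
    MeasurableSet (reindex (fun k => (g k : ℕ)) ⁻¹' A : Set (EdgeNetwork ℕ)) := by
  have h : (reindex (fun k => (g k : ℕ)) : EdgeNetwork ℕ → _) = reindex g ∘ restrict N := by
    funext E
    induction E using Quotient.inductionOn with
    | h I => rfl
  rw [h, Set.preimage_comp]
  exact measurableSet_restrict _ _

/-- Injective choices of indices each contribute exactly `μ (restrict n ⁻¹' A)`; the others are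
bounded by 1 each. -/
theorem lintegral_average_reindex_le {μ : Measure (EdgeNetwork ℕ)} [IsProbabilityMeasure μ]
    (hμ : ∀ σ, μ.map (relabel σ) = μ) {n N : ℕ} (hN : N ≠ 0) (A : Set (EdgeNetwork (Fin n))) :
    ∫⁻ E, (∑ g : Fin n → Fin N, (reindex (fun k => (g k : ℕ)) ⁻¹' A).indicator 1 E)
        / (N : ℝ≥0∞) ^ n ∂μ
      ≤ μ (restrict n ⁻¹' A)
        + Fintype.card {g : Fin n → Fin N // ¬ Function.Injective g} / (N : ℝ≥0∞) ^ n := by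
  classical
  have hN0 : (N : ℝ≥0∞) ^ n ≠ 0 := by positivity
  have hN1 : (N : ℝ≥0∞) ^ n ≠ ∞ := ENNReal.pow_ne_top (ENNReal.natCast_ne_top N)
  have hmeas := fun g : Fin n → Fin N => measurableSet_preimage_reindex g A
  simp only [div_eq_mul_inv]
  rw [lintegral_mul_const' _ _ (ENNReal.inv_ne_top.2 hN0),
    lintegral_finsetSum _ fun g _ => measurable_one.indicator (hmeas g)]
  simp only [lintegral_indicator_one (hmeas _)]
  have hle : ∀ g : Fin n → Fin N, μ (reindex (fun k => (g k : ℕ)) ⁻¹' A)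
      ≤ μ (restrict n ⁻¹' A) + if ¬ Function.Injective g then 1 else 0 := by
    intro g
    by_cases hg : Function.Injective g
    · rw [measure_preimage_reindex hμ (g := fun k => (g k : ℕ)) (Fin.val_injective.comp hg)]
      simp
    · rw [if_pos hg]
      exact prob_le_one.trans le_add_self
  refine (mul_le_mul_left (Finset.sum_le_sum fun g _ => hle g) _).trans_eq ?_
  rw [Finset.sum_add_distrib, add_mul]
  congr 1
  · simp only [Finset.sum_const, Finset.card_univ, Fintype.card_fun, Fintype.card_fin,
      nsmul_eq_mul, Nat.cast_pow]
    rw [mul_right_comm, ENNReal.mul_inv_cancel hN0 hN1, one_mul]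
  · rw [Fintype.card_subtype, Finset.sum_boole]

/-- Fatou is applied twice, to the sum over `t` and to the integral over `E`. Only an inequality
results, and `eq_mixtureLaw` recovers equality. -/
theorem lintegral_tsum_prod_frequency_le {μ : Measure (EdgeNetwork ℕ)} [IsProbabilityMeasure μ]
    (hμ : ∀ σ, μ.map (relabel σ) = μ) (n : ℕ) (A : Set (EdgeNetwork (Fin n))) :
    ∫⁻ E, ∑' t : Fin n → Interaction,
        (network ⁻¹' A).indicator (fun t => ∏ k, frequency (t k) E) t ∂μ
      ≤ μ (restrict n ⁻¹' A) := by
  have hfatou : ∀ᵐ E ∂μ, ∑' t : Fin n → Interaction,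
        (network ⁻¹' A).indicator (fun t => ∏ k, frequency (t k) E) t
      ≤ liminf (fun k : ℕ => ∑' t : Fin n → Interaction,
        (network ⁻¹' A).indicator (fun t => ∏ i, empirical (4 ^ k) (t i) E) t) atTop := by
    filter_upwards [ae_tendsto_empirical hμ] with E hE
    let _ : MeasurableSpace (Fin n → Interaction) := ⊤
    have h := lintegral_liminf_le (μ := (Measure.count : Measure (Fin n → Interaction)))
      (u := atTop) (f := fun (k : ℕ) =>
        (network ⁻¹' A).indicator (fun t => ∏ i, empirical (4 ^ k) (t i) E))
        fun _ => measurable_from_top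
    simp only [lintegral_count] at h
    refine le_trans (ENNReal.tsum_le_tsum fun t => le_of_eq ?_) h
    by_cases ht : t ∈ network ⁻¹' A
    · simp only [Set.indicator_of_mem ht]
      exact (ENNReal.tendsto_finsetProd_of_ne_top _ (fun i _ => hE (t i))
        fun i _ => frequency_ne_top _ _).liminf_eq.symm
    · simp [Set.indicator_of_notMem ht]
  refine (lintegral_mono_ae hfatou).trans ((lintegral_liminf_le fun k => ?_).trans ?_)
  · simp only [tsum_indicator_prod_empirical]
    exact (Finset.measurable_fun_sum _ fun g _ =>
      measurable_one.indicator (measurableSet_preimage_reindex g A)).div_const _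
  · simp only [tsum_indicator_prod_empirical]
    refine (liminf_le_liminf (.of_forall fun k =>
      lintegral_average_reindex_le hμ (by positivity) A)).trans_eq ?_
    have h := (tendsto_card_not_injective_div n (u := fun k => 4 ^ k)
      (tendsto_pow_atTop_atTop_of_one_lt (by norm_num))).const_add (μ (restrict n ⁻¹' A))
    rw [add_zero] at h
    exact h.liminf_eq

/-- The restrictions to finitely many edges determine a finite measure on networks. -/
theorem measure_ext {μ ν : Measure (EdgeNetwork ℕ)} [IsFiniteMeasure μ]
    (h : ∀ n (A : Set (EdgeNetwork (Fin n))), μ (restrict n ⁻¹' A) = ν (restrict n ⁻¹' A)) :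
    μ = ν := by
  -- The events seen by the first `n` edges increase with `n`, so their union is a π-system; `n = 0`
  -- compares the total masses.
  refine ext_of_generate_finite
    (⋃ n : ℕ, {B | MeasurableSet[MeasurableSpace.comap (restrict n) ⊤] B})
    (MeasurableSpace.generateFrom_iUnion_measurableSet _).symm
    (isPiSystem_iUnion_of_monotone _ (fun n => @MeasurableSpace.isPiSystem_measurableSet _
      (MeasurableSpace.comap (restrict n) ⊤)) ?_) ?_ (h 0 Set.univ)
  · rintro n m hnm _ ⟨A, -, rfl⟩
    refine ⟨reindex (Fin.castLE hnm) ⁻¹' A, trivial, ?_⟩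
    rw [← Set.preimage_comp]
    congr 1
    funext E
    induction E using Quotient.inductionOn with
    | h I => rfl
  · rintro B hB
    obtain ⟨n, A, -, rfl⟩ := Set.mem_iUnion.1 hB
    exact h n A

end EdgeNetwork

/-! ### Finite-dimensional laws of the i.i.d. network -/

namespace Simplex

instance (f : Simplex) : IsProbabilityMeasure f.iidLaw := by
  unfold iidLaw
  infer_instance

instance (f : Simplex) : IsProbabilityMeasure f.networkLaw :=
  Measure.isProbabilityMeasure_map measurable_network.aemeasurable

theorem networkLaw_restrict (f : Simplex) (n : ℕ) (A : Set (EdgeNetwork (Fin n))) :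
    f.networkLaw (EdgeNetwork.restrict n ⁻¹' A)
      = ∑' t : Fin n → Interaction,
        (network ⁻¹' A).indicator (fun t => ∏ k, ENNReal.ofReal (f.1 (t k))) t := by
  rw [networkLaw, Measure.map_apply measurable_network (EdgeNetwork.measurableSet_restrict n A)]
  set r : InteractionProcess ℕ → Fin n → Interaction := fun I k => I k
  have hr : Measurable r := by fun_prop
  have hpre : network ⁻¹' (EdgeNetwork.restrict n ⁻¹' A) = r ⁻¹' (network ⁻¹' A) := rfl
  rw [hpre, ← Measure.map_apply hr (Set.to_countable _).measurableSet,
    ← Measure.tsum_indicator_apply_singleton _ _ (Set.to_countable _).measurableSet]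
  refine tsum_congr fun t => ?_
  congr 1
  funext t
  rw [Measure.map_apply hr (measurableSet_singleton t)]
  -- The constraint is stated for all `i : ℕ` and is vacuous for `i ≥ n`, which avoids a dependent
  -- index.
  have hpi : r ⁻¹' {t} = ((Finset.range n : Finset ℕ) : Set ℕ).pi
      fun i => {s | ∀ h : i < n, s = t ⟨i, h⟩} := by
    ext I
    simp only [r, Set.mem_preimage, Set.mem_singleton_iff, funext_iff, Set.mem_pi,
      Finset.coe_range, Set.mem_Iio, Set.mem_ofPred_eq]
    exact ⟨fun h i _ hi => h ⟨i, hi⟩, fun h k => h k k.2 k.2⟩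
  rw [hpi, iidLaw, Measure.infinitePi_pi _ fun _ _ => MeasurableSet.of_discrete,
    ← Fin.prod_univ_eq_prod_range (fun i => f.toPMF.toMeasure {s | ∀ h : i < n, s = t ⟨i, h⟩})]
  refine Finset.prod_congr rfl fun k _ => ?_
  have hk : {s | ∀ h : (k : ℕ) < n, s = t ⟨k, h⟩} = {t k} := by
    ext s
    simp
  rw [hk, PMF.toMeasure_apply_singleton _ _ (measurableSet_singleton _)]
  rfl

/-- The simplex element concentrated on the empty interaction. -/
noncomputable def atNil : Simplex :=
  ⟨fun s => if s = [] then 1 else 0, fun s => by beta_reduce; split_ifs <;> norm_num, hasSum_ite_eq [] 1⟩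

end Simplex

/-! ### The mixing measure -/

namespace EdgeNetwork

/-- The asymptotic frequencies of a network whose frequencies sum to one. -/
noncomputable def frequenciesOfSum (E : EdgeNetwork ℕ) (h : ∑' s, frequency s E = 1) : Simplex :=
  ⟨fun s => (frequency s E).toReal, fun _ => ENNReal.toReal_nonneg, by
    have hs := (ENNReal.summable_toReal (h ▸ ENNReal.one_ne_top)).hasSum
    rwa [← ENNReal.tsum_toReal_eq fun s => frequency_ne_top s E, h, ENNReal.toReal_one] at hs⟩

open Classical in
/-- The asymptotic frequencies of a network, as a point of the simplex whenever they sum to one. -/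
noncomputable def frequencies (E : EdgeNetwork ℕ) : Simplex :=
  -- The default is arbitrary: for the laws considered it is used only on a null set.
  if h : ∑' s, frequency s E = 1 then E.frequenciesOfSum h else Simplex.atNil

theorem ofReal_frequencies {E : EdgeNetwork ℕ} (h : ∑' s, frequency s E = 1) (s : Interaction) :
    ENNReal.ofReal (E.frequencies.1 s) = frequency s E := by
  rw [frequencies, dif_pos h]
  exact ENNReal.ofReal_toReal (frequency_ne_top s E)

theorem measurable_frequencies : Measurable frequencies := by
  classical
  suffices hc : ∀ s, Measurable fun E : EdgeNetwork ℕ => E.frequencies.1 s from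
    (measurable_pi_iff.2 hc).subtype_mk
  intro s
  have h : (fun E : EdgeNetwork ℕ => E.frequencies.1 s) = fun E =>
      if ∑' s, frequency s E = 1 then (frequency s E).toReal else Simplex.atNil.1 s := by
    funext E
    unfold frequencies
    split_ifs <;> rfl
  rw [h]
  exact Measurable.ite
    (Measurable.tsum (fun s => measurable_frequency s) (measurableSet_singleton 1))
    (measurable_frequency s).ennreal_toReal measurable_const

theorem eq_mixtureLaw {μ : Measure (EdgeNetwork ℕ)} [IsProbabilityMeasure μ]
    (hμ : ∀ σ, μ.map (relabel σ) = μ) (hblip : ∀ᵐ E ∂μ, E.BlipFree) :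
    μ = mixtureLaw (μ.map frequencies) := by
  have : IsProbabilityMeasure (μ.map frequencies) :=
    Measure.isProbabilityMeasure_map measurable_frequencies.aemeasurable
  have hprob : IsProbabilityMeasure (mixtureLaw (μ.map frequencies)) :=
    ⟨by rw [mixtureLaw_apply _ MeasurableSet.univ]; simp⟩
  have hle : ∀ n (A : Set (EdgeNetwork (Fin n))),
      mixtureLaw (μ.map frequencies) (restrict n ⁻¹' A) ≤ μ (restrict n ⁻¹' A) := by
    intro n A
    have hA := measurableSet_restrict n A
    rw [mixtureLaw_apply _ hA, lintegral_map (f := fun f : Simplex => f.networkLaw (restrict n ⁻¹' A))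
      ((Measure.measurable_coe hA).comp Simplex.measurable_networkLaw) measurable_frequencies]
    refine le_trans (le_of_eq (lintegral_congr_ae ?_)) (lintegral_tsum_prod_frequency_le hμ n A)
    filter_upwards [ae_tsum_frequency_eq_one hμ hblip] with E hE
    simp only [Simplex.networkLaw_restrict, ofReal_frequencies hE]
  refine measure_ext fun n A => le_antisymm ?_ (hle n A)
  have hA := measurableSet_restrict n A
  -- For probability measures, the inequality for the complement is the reverse inequality for `A`.
  have hc := hle n Aᶜ
  rw [Set.preimage_compl, prob_compl_eq_one_sub hA, prob_compl_eq_one_sub hA] at hc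
  exact (ENNReal.sub_le_sub_iff_left prob_le_one ENNReal.one_ne_top).1 hc

end EdgeNetwork
end EdgeExch

theorem theorem4p2 {Ω : Type*} [MeasurableSpace Ω] (P : Measure Ω) [IsProbabilityMeasure P]
    (Y : Ω → EdgeExch.EdgeNetwork ℕ) (hY : Measurable Y)
    (hexch : EdgeExch.EdgeExchangeable P Y)
    (hblip : ∀ᵐ ω ∂P, (Y ω).BlipFree) :
    ∃ φ : Measure EdgeExch.Simplex, IsProbabilityMeasure φ ∧
      P.map Y = EdgeExch.mixtureLaw φ := by
  have : IsProbabilityMeasure (P.map Y) := Measure.isProbabilityMeasure_map hY.aemeasurable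
  refine ⟨(P.map Y).map EdgeExch.EdgeNetwork.frequencies,
    Measure.isProbabilityMeasure_map EdgeExch.EdgeNetwork.measurable_frequencies.aemeasurable,
    EdgeExch.EdgeNetwork.eq_mixtureLaw (fun σ => ?_) ?_⟩
  · rw [Measure.map_map (EdgeExch.EdgeNetwork.measurable_relabel σ) hY]
    exact (hexch σ).map_eq
  · exact (ae_map_iff hY.aemeasurable EdgeExch.EdgeNetwork.measurableSet_blipFree).2 hblip
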